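/- Let $n\ge 1$. A rearrangement-invariant (r.i.) norm over a $\sigma$-finite nonatomic measure space $(R,\mu)$ is a functional $\varrho$, defined on the $\mu$-measurable functions with values in $[0,\infty]$ and with values in $[0,\infty]$, such that for all such $f,g,f_j$ and all $\lambda\ge0$: 1. $\varrho(f)=0$ iff $f=0$ a.e., $\varrho(\lambda f)=\lambda\varrho(f)$, and $\varrho(f+g)\le\varrho(f)+\varrho(g)$; 2. $f\le g$ a.e. implies $\varrho(f)\le\varrho(g)$; 3. $f_j\nearrow f$ a.e. implies $\varrho(f_j)\nearrow\varrho(f)$; 4. $\varrho(\chi_E)<\infty$ whenever $\mu(E)<\infty$; 5. if $\mu(E)<\infty$, there is a constant $C_E<\infty$ with $\int_E f\,d\mu\le C_E\,\varrho(f)$ for all $f$; 6. $\varrho(f)=\varrho(g)$ whenever $f^*=g^*$ on $(0,\infty)$, where $f^*(t)=\inf\{\lambda\in(0,\infty):\mu(\{|f|>\lambda\})\le t\}$ for $t\in(0,\infty)$. The corresponding r.i. space is $X=\{f:\ \|f\|_X:=\varrho(|f|)<\infty\}$. Its associate space $X'$ is the r.i. space given by the norm $\varrho'(g)=\sup\{\int_R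 fg\,d\mu:\ f\ge0 \text{ measurable},\ \varrho(f)\le1\}$. For an r.i. space $Z$ over $\mathbb R^n$ (with Lebesgue measure), $Z(0,\infty)$ denotes its representation space, that is, the unique r.i. space over $(0,\infty)$ (with Lebesgue measure) such that $\|f\|_Z=\|f^*\|_{Z(0,\infty)}$ for every measurable $f$ on $\mathbb R^n$. Finally, $V^1X(\mathbb R^n)$ is the set of all $u\in L^1_{\mathrm{loc}}(\mathbb R^n)$ that are weakly differentiable on $\mathbb R^n$ and satisfy $|\nabla u|\in X$, where $|\nabla u|$ is the $\ell^1$-norm of the weak gradient of $u$. **Proposition.** Let $X$ be an r.i. space over $\mathbb R^n$ such that $t^{\frac1n-1}\chi_{(1,\infty)}(t)\in X'(0,\infty)$, let $u\in V^1X(\mathbb R^n)$, and let $B_k$, $k\in\mathbb N$, be balls in $\mathbb R^n$ such that $B_k\subseteq B_{k+1}$ for each $k\in\mathbb N$. Set $$\lambda_k=\frac1{|B_k|}\int_{B_k}u(x)\,dx,\qquad k\in\mathbb N.$$ Then the sequence $\{\lambda_k\}_{k=1}^\infty$ is bounded. In particular, it has a convergent subsequence. -/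

import Mathlib

open MeasureTheory Set Filter Topology
open scoped ENNReal NNReal

/-- The nonincreasing rearrangement of a function `f` with values in `[0,∞]`:
`f^*(t) = inf {l ∈ (0,∞) : μ {s : f s > l} ≤ t}`, for `t ∈ (0,∞)`.
(Values at `t ≤ 0` are irrelevant.) -/
noncomputable def rearrangement {α : Type*} [MeasurableSpace α] (μ : Measure α)
    (f : α → ℝ≥0∞) (t : ℝ) : ℝ≥0∞ :=
  sInf {l : ℝ≥0∞ | 0 < l ∧ l < ∞ ∧ μ {s | l < f s} ≤ ENNReal.ofReal t}

/-- `ρ` is a rearrangement-invariant Banach function norm on the class of `μ`-measurable functions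
with values in `[0,∞]`. The values of `ρ` on nonmeasurable functions are irrelevant. -/
structure IsRINorm {α : Type*} [MeasurableSpace α] (μ : Measure α)
    (ρ : (α → ℝ≥0∞) → ℝ≥0∞) : Prop where
  /-- norm axiom: definiteness -/
  eq_zero_iff : ∀ f, AEMeasurable f μ → (ρ f = 0 ↔ f =ᵐ[μ] 0)
  /-- norm axiom: positive homogeneity -/
  smul : ∀ (c : ℝ≥0) (f), AEMeasurable f μ → ρ (fun x => c * f x) = c * ρ f
  /-- norm axiom: triangle inequality -/
  add_le : ∀ f g, AEMeasurable f μ → AEMeasurable g μ → ρ (fun x => f x + g x) ≤ ρ f + ρ g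
  /-- lattice axiom -/
  mono : ∀ f g, AEMeasurable f μ → AEMeasurable g μ → f ≤ᵐ[μ] g → ρ f ≤ ρ g
  /-- Fatou axiom -/
  fatou : ∀ (f : ℕ → α → ℝ≥0∞) (g : α → ℝ≥0∞), (∀ j, AEMeasurable (f j) μ) → AEMeasurable g μ →
    (∀ᵐ x ∂μ, Monotone (fun j => f j x) ∧ Tendsto (fun j => f j x) atTop (𝓝 (g x))) →
    Monotone (fun j => ρ (f j)) ∧ Tendsto (fun j => ρ (f j)) atTop (𝓝 (ρ g))
  /-- nontriviality axiom -/
  indicator_lt_top : ∀ E, MeasurableSet E → μ E < ∞ → ρ (E.indicator fun _ => 1) < ∞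
  /-- local embedding in `L¹` -/
  lintegral_le : ∀ E, MeasurableSet E → μ E < ∞ →
    ∃ C : ℝ≥0, ∀ f, AEMeasurable f μ → ∫⁻ x in E, f x ∂μ ≤ C * ρ f
  /-- rearrangement-invariance axiom -/
  rearrangement_invariant : ∀ f g, AEMeasurable f μ → AEMeasurable g μ →
    (∀ t : ℝ, 0 < t → rearrangement μ f t = rearrangement μ g t) → ρ f = ρ g

/-- The associate norm `ρ'(g) = sup {∫ f g dμ : f ≥ 0 measurable, ρ(f) ≤ 1}`. -/
noncomputable def associateNorm {α : Type*} [MeasurableSpace α] (μ : Measure α)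
    (ρ : (α → ℝ≥0∞) → ℝ≥0∞) (g : α → ℝ≥0∞) : ℝ≥0∞ :=
  ⨆ (f : α → ℝ≥0∞) (_ : AEMeasurable f μ) (_ : ρ f ≤ 1), ∫⁻ x, f x * g x ∂μ

/-- For `g` on `(0,∞)`, the function `x ↦ g^*(|B(0,|x|)|) = g^*(ωₙ |x|ⁿ)` on `ℝⁿ`, which has the
same nonincreasing rearrangement as `g`. -/
noncomputable def radialRearrangement (n : ℕ) (g : ℝ → ℝ≥0∞) (x : EuclideanSpace ℝ (Fin n)) :
    ℝ≥0∞ :=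
  rearrangement (volume.restrict (Ioi (0 : ℝ))) g
    (volume (Metric.ball (0 : EuclideanSpace ℝ (Fin n)) ‖x‖)).toReal

/-- The norm of the representation space over `(0,∞)` (with Lebesgue measure) of the r.i. space
over `ℝⁿ` given by `ρ`. It is the unique rearrangement-invariant norm `σ` over `(0,∞)` with
`ρ(f) = σ(f^*)` for all `f`; see `eq_representationNorm_rearrangement` and
`eq_representationNorm_of_represents` below. -/
noncomputable def representationNorm (n : ℕ)
    (ρ : (EuclideanSpace ℝ (Fin n) → ℝ≥0∞) → ℝ≥0∞) (g : ℝ → ℝ≥0∞) : ℝ≥0∞ :=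
  ρ (radialRearrangement n g)

/-- `v` is the weak (distributional) `i`-th partial derivative of `u` on `ℝⁿ`: `v` is locally
integrable and `∫ u ∂ᵢφ = - ∫ v φ` for every test function `φ ∈ C_c^∞(ℝⁿ)`. -/
def IsWeakPartialDeriv {n : ℕ} (i : Fin n) (u v : EuclideanSpace ℝ (Fin n) → ℝ) : Prop :=
  LocallyIntegrable v volume ∧
    ∀ φ : EuclideanSpace ℝ (Fin n) → ℝ, ContDiff ℝ ((⊤ : ℕ∞) : WithTop ℕ∞) φ → HasCompactSupport φ →
      ∫ x, u x * fderiv ℝ φ x (EuclideanSpace.single i 1) = -∫ x, v x * φ x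

/-- The Sobolev-type space `V¹X(ℝⁿ)`, where `X` is the r.i. space given by `ρ`: the locally
integrable, weakly differentiable functions `u` such that the `ℓ¹`-norm of the weak gradient
belongs to `X`; no integrability of `u` beyond local integrability is required. -/
def sobolevV1 (n : ℕ) (ρ : (EuclideanSpace ℝ (Fin n) → ℝ≥0∞) → ℝ≥0∞) :
    Set (EuclideanSpace ℝ (Fin n) → ℝ) :=
  {u | LocallyIntegrable u volume ∧
    ∃ v : Fin n → EuclideanSpace ℝ (Fin n) → ℝ,
      (∀ i, IsWeakPartialDeriv i u (v i)) ∧ ρ (fun x => ∑ i, ‖v i x‖ₑ) < ∞}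

theorem lt_rearrangement_iff {α : Type*} [MeasurableSpace α] (μ : Measure α)
    (f : α → ℝ≥0∞) (t : ℝ) (l : ℝ≥0∞) :
    l < rearrangement μ f t ↔ ENNReal.ofReal t < μ {s | l < f s} := by
  constructor
  · intro h
    by_contra! hle
    refine absurd h (not_lt.2 ?_)
    rcases eq_or_ne l ∞ with rfl | hl
    · exact le_top
    refine le_of_forall_gt fun c hc => ?_
    obtain ⟨d, hd, hdc⟩ := exists_between hc
    refine lt_of_le_of_lt (sInf_le ⟨bot_le.trans_lt hd, hdc.trans_le le_top, ?_⟩) hdc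
    exact (measure_mono fun s (hs : d < f s) => hd.trans hs).trans hle
  · intro h
    by_contra! hle
    refine absurd h (not_lt.2 ?_)
    rcases eq_or_ne l ∞ with rfl | hl
    · simp
    obtain ⟨u, hu, hlu, hlim⟩ := exists_seq_strictAnti_tendsto' (show l < ∞ from hl.lt_top)
    have hU : {s | l < f s} = ⋃ k, {s | u k < f s} := by
      ext s
      simp only [mem_ofPred_eq, mem_iUnion]
      constructor
      · intro hs
        exact (hlim.eventually (gt_mem_nhds hs)).exists
      · rintro ⟨k, hk⟩
        exact (hlu k).1.trans hk
    have hm : Monotone fun k => {s | u k < f s} := fun a b hab s (hs : u a < f s) =>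
      (hu.antitone hab).trans_lt hs
    rw [hU, hm.measure_iUnion]
    refine iSup_le fun k => ?_
    obtain ⟨d, ⟨_, _, hd⟩, hdk⟩ := sInf_lt_iff.1 (hle.trans_lt (hlu k).1)
    exact (measure_mono fun s (hs : u k < f s) => hdk.trans hs).trans hd

theorem rearrangement_congr {α β : Type*} [MeasurableSpace α] [MeasurableSpace β] (μ : Measure α)
    (ν : Measure β) (f : α → ℝ≥0∞) (g : β → ℝ≥0∞) (h : ∀ l, μ {s | l < f s} = ν {s | l < g s}) :
    rearrangement μ f = rearrangement ν g := by
  funext t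
  simp only [rearrangement, h]

theorem antitone_rearrangement {α : Type*} [MeasurableSpace α] (μ : Measure α)
    (f : α → ℝ≥0∞) : Antitone (rearrangement μ f) := fun _ _ h =>
  sInf_le_sInf fun _ hl => ⟨hl.1, hl.2.1, hl.2.2.trans (ENNReal.ofReal_le_ofReal h)⟩

theorem rearrangement_rearrangement {α : Type*} [MeasurableSpace α] (μ : Measure α)
    (f : α → ℝ≥0∞) :
    rearrangement (volume.restrict (Ioi (0 : ℝ))) (rearrangement μ f) = rearrangement μ f := by
  refine rearrangement_congr _ _ _ _ fun l => ?_
  simp only [lt_rearrangement_iff]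
  rw [Measure.restrict_apply' measurableSet_Ioi]
  rcases eq_or_ne (μ {s | l < f s}) ∞ with h | h
  · rw [h]; simp
  · have : {s : ℝ | ENNReal.ofReal s < μ {s | l < f s}} ∩ Ioi 0
        = Ioo 0 (μ {s | l < f s}).toReal := by
      ext s
      simp only [mem_inter_iff, mem_ofPred_eq, mem_Ioi, mem_Ioo]
      constructor
      · rintro ⟨h1, h2⟩; exact ⟨h2, (ENNReal.ofReal_lt_iff_lt_toReal h2.le h).1 h1⟩
      · rintro ⟨h1, h2⟩; exact ⟨(ENNReal.ofReal_lt_iff_lt_toReal h1.le h).2 h2, h1⟩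
    rw [this, Real.volume_Ioo, sub_zero, ENNReal.ofReal_toReal h]

theorem measurable_radialRearrangement (n : ℕ) (g : ℝ → ℝ≥0∞) :
    Measurable (radialRearrangement n g) := by
  have h : Monotone fun r : ℝ =>
      (volume (Metric.ball (0 : EuclideanSpace ℝ (Fin n)) r)).toReal := fun a b hab =>
    ENNReal.toReal_mono measure_ball_lt_top.ne (measure_mono (Metric.ball_subset_ball hab))
  exact (antitone_rearrangement _ g).measurable.comp (h.measurable.comp measurable_norm)

theorem rearrangement_radialRearrangement (n : ℕ) (hn : 1 ≤ n) (g : ℝ → ℝ≥0∞) :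
    rearrangement volume (radialRearrangement n g)
      = rearrangement (volume.restrict (Ioi (0 : ℝ))) g := by
  have : Nonempty (Fin n) := ⟨⟨0, hn⟩⟩
  refine rearrangement_congr _ _ _ _ fun l => ?_
  simp only [radialRearrangement, lt_rearrangement_iff,
    ENNReal.ofReal_toReal measure_ball_lt_top.ne]
  set d := (volume.restrict (Ioi (0 : ℝ))) {s | l < g s} with hd
  have hw : 0 < volume (Metric.ball (0 : EuclideanSpace ℝ (Fin n)) 1) :=
    Metric.measure_ball_pos _ _ one_pos
  set w := (volume (Metric.ball (0 : EuclideanSpace ℝ (Fin n)) 1)).toReal with hwd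
  have hw0 : 0 < w := ENNReal.toReal_pos hw.ne' measure_ball_lt_top.ne
  have hvol : ∀ r : ℝ, 0 ≤ r → volume (Metric.ball (0 : EuclideanSpace ℝ (Fin n)) r)
      = ENNReal.ofReal (w * r ^ n) := by
    intro r hr
    rw [Measure.addHaar_ball _ _ hr, mul_comm w, ENNReal.ofReal_mul (pow_nonneg hr n),
      ENNReal.ofReal_toReal measure_ball_lt_top.ne, finrank_euclideanSpace_fin]
  rcases eq_or_ne d ∞ with h | h
  · rw [h]
    simp only [measure_ball_lt_top, ofPred_true]
    exact measure_univ_of_isAddLeftInvariant _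
  · set R : ℝ := (d.toReal / w) ^ (1 / (n : ℝ)) with hR
    have hq : 0 ≤ d.toReal / w := by positivity
    have hR0 : 0 ≤ R := Real.rpow_nonneg hq _
    have hRn : R ^ n = d.toReal / w := by
      rw [hR, one_div, Real.rpow_inv_natCast_pow hq (by omega)]
    have hset : {x : EuclideanSpace ℝ (Fin n) |
        volume (Metric.ball (0 : EuclideanSpace ℝ (Fin n)) ‖x‖) < d} = Metric.ball 0 R := by
      ext x
      rw [mem_ofPred_eq, hvol _ (norm_nonneg x), mem_ball_zero_iff,
        ENNReal.ofReal_lt_iff_lt_toReal (by positivity) h,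
        ← pow_lt_pow_iff_left₀ (norm_nonneg x) hR0 (by omega : n ≠ 0), hRn, lt_div_iff₀' hw0]
    rw [hset, hvol _ hR0, hRn, mul_div_cancel₀ _ hw0.ne', ENNReal.ofReal_toReal h]

/-- The representation norm represents: `ρ(f) = σ(f^*)` for `σ = representationNorm n ρ`. -/
theorem eq_representationNorm_rearrangement (n : ℕ) (hn : 1 ≤ n)
    (ρ : (EuclideanSpace ℝ (Fin n) → ℝ≥0∞) → ℝ≥0∞) (hρ : IsRINorm volume ρ)
    (f : EuclideanSpace ℝ (Fin n) → ℝ≥0∞) (hf : AEMeasurable f) :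
    ρ f = representationNorm n ρ (rearrangement volume f) :=
  hρ.rearrangement_invariant _ _ hf (measurable_radialRearrangement _ _).aemeasurable fun t _ => by
    rw [rearrangement_radialRearrangement n hn, rearrangement_rearrangement]

/-- Every rearrangement-invariant norm over `(0,∞)` that represents `ρ` is the representation
norm. -/
theorem eq_representationNorm_of_represents (n : ℕ) (hn : 1 ≤ n)
    (ρ : (EuclideanSpace ℝ (Fin n) → ℝ≥0∞) → ℝ≥0∞) (σ : (ℝ → ℝ≥0∞) → ℝ≥0∞)
    (hσ : IsRINorm (volume.restrict (Ioi (0 : ℝ))) σ)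
    (h : ∀ f, AEMeasurable f → ρ f = σ (rearrangement volume f))
    (g : ℝ → ℝ≥0∞) (hg : AEMeasurable g (volume.restrict (Ioi (0 : ℝ)))) :
    σ g = representationNorm n ρ g := by
  rw [representationNorm, h _ (measurable_radialRearrangement _ _).aemeasurable,
    rearrangement_radialRearrangement n hn]
  exact hσ.rearrangement_invariant _ _ hg (antitone_rearrangement _ _).measurable.aemeasurable
    fun t _ => by rw [rearrangement_rearrangement]

/-! Two nested balls `B ⊆ B'` of radii `r < r'` are homothetic: `y ↦ p + a (y - p)` with `a = r /
r'` carries `B'` onto `B`, and its fixed point `p` lies within `r` of the centre of `B`. So the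
difference of the averages of `u` is `|B|⁻¹ ∫ u (χ_B(y) - aⁿ χ_B(p + a (y - p))) dy`. The bracket is
the divergence of the radial field `(y - p) J(y)`, where `J` averages `χ_B` along rays from `p`
(`rayIntegral_euler`). After smoothing `χ_B`, integration by parts moves the derivative onto `u`.
Since `B` lies within `2 r` of `p`, the field has size at most a constant times `(2 + ω |y -
p|ⁿ)^(1/n - 1)`, with `ω` the volume of the unit ball and a constant depending on `n` and `r` alone
(`norm_sub_mul_rayIntegral_le`). This kernel is dominated by a translate of the radial rearrangement
of `t^(1/n - 1) χ_(1,∞)`, so Hölder's inequality and translation invariance bound the difference of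
averages independently of `B'` and `p`. Comparing every ball with the first one proves boundedness.
-/

/-! ### Hölder's inequality and translation invariance -/

theorem lintegral_mul_le_associateNorm {α : Type*} [MeasurableSpace α] {μ : Measure α}
    {ρ : (α → ℝ≥0∞) → ℝ≥0∞} (hρ : IsRINorm μ ρ) {f g : α → ℝ≥0∞} (hf : AEMeasurable f μ)
    (hfin : ρ f < ∞) : ∫⁻ x, f x * g x ∂μ ≤ ρ f * associateNorm μ ρ g := by
  rcases eq_or_ne (ρ f) 0 with h0 | h0
  · have hz := (hρ.eq_zero_iff f hf).1 h0
    rw [lintegral_eq_zero_of_ae_eq_zero (hz.mono fun x hx => by simp [hx])]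
    exact zero_le
  · lift ρ f to ℝ≥0 using hfin.ne with a ha
    have ha0 : a ≠ 0 := by simpa using h0
    have hfa : AEMeasurable (fun x => ((a⁻¹ : ℝ≥0) : ℝ≥0∞) * f x) μ := hf.const_mul _
    have h1 : ρ (fun x => ((a⁻¹ : ℝ≥0) : ℝ≥0∞) * f x) ≤ 1 := by
      rw [hρ.smul _ _ hf, ← ha, ← ENNReal.coe_mul, inv_mul_cancel₀ ha0, ENNReal.coe_one]
    have h2 : ∫⁻ x, ((a⁻¹ : ℝ≥0) : ℝ≥0∞) * f x * g x ∂μ ≤ associateNorm μ ρ g :=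
      le_iSup₂_of_le _ hfa (le_iSup_of_le h1 le_rfl)
    calc ∫⁻ x, f x * g x ∂μ
        = ∫⁻ x, a * (((a⁻¹ : ℝ≥0) : ℝ≥0∞) * f x * g x) ∂μ := by
          refine lintegral_congr fun x => ?_
          rw [← mul_assoc, ← mul_assoc, ← ENNReal.coe_mul, mul_inv_cancel₀ ha0, ENNReal.coe_one,
            one_mul]
      _ = a * ∫⁻ x, ((a⁻¹ : ℝ≥0) : ℝ≥0∞) * f x * g x ∂μ :=
          lintegral_const_mul' _ _ ENNReal.coe_ne_top
      _ ≤ a * associateNorm μ ρ g := by gcongr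

/-- Translation preserves the measure of every superlevel set, hence the rearrangement. -/
theorem IsRINorm.comp_add_right {G : Type*} [AddGroup G] [MeasurableSpace G]
    [MeasurableAdd G] {μ : Measure G} [μ.IsAddRightInvariant] {ρ : (G → ℝ≥0∞) → ℝ≥0∞}
    (hρ : IsRINorm μ ρ) {f : G → ℝ≥0∞} (hf : AEMeasurable f μ) (p : G) :
    ρ (fun x => f (x + p)) = ρ f := by
  have hmp := measurePreserving_add_right μ p
  refine hρ.rearrangement_invariant _ _
    (hf.comp_quasiMeasurePreserving hmp.quasiMeasurePreserving) hf fun t _ => ?_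
  refine congrFun (rearrangement_congr _ _ _ _ fun l => ?_) t
  exact hmp.measure_preimage (nullMeasurableSet_lt aemeasurable_const hf)

/-- The translation is shifted from `g` to `f`, so only the invariance of `ρ` is needed, not that of
its associate norm. This makes the final bound independent of the centre of homothety. -/
theorem lintegral_mul_sub_le_associateNorm {G : Type*} [AddGroup G] [MeasurableSpace G]
    [MeasurableAdd G] {μ : Measure G} [μ.IsAddRightInvariant] {ρ : (G → ℝ≥0∞) → ℝ≥0∞}
    (hρ : IsRINorm μ ρ) {f g : G → ℝ≥0∞} (hf : AEMeasurable f μ) (hfin : ρ f < ∞) (p : G) :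
    ∫⁻ x, f x * g (x - p) ∂μ ≤ ρ f * associateNorm μ ρ g := by
  rw [← lintegral_add_right_eq_self _ p]
  simp only [add_sub_cancel_right]
  rw [← hρ.comp_add_right hf p] at hfin ⊢
  exact lintegral_mul_le_associateNorm hρ
    (hf.comp_quasiMeasurePreserving (measurePreserving_add_right μ p).quasiMeasurePreserving) hfin

/-! ### The kernel and the rearrangement of the truncated power -/

theorem le_rearrangement_indicator_rpow {s t : ℝ} (hs : s ≤ 0) (ht : 0 ≤ t) :
    ENNReal.ofReal ((2 + t) ^ s) ≤ rearrangement (volume.restrict (Ioi (0 : ℝ)))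
      ((Ioi (1 : ℝ)).indicator fun t => ENNReal.ofReal (t ^ s)) t := by
  refine le_of_forall_lt fun l hl => ?_
  rw [lt_rearrangement_iff]
  -- The interval has length `1 + t`. The base `2 + t`, rather than the sharp `1 + t`, leaves room
  -- for the strict inequality with `t`.
  have hsub : Ioo (1 : ℝ) (2 + t) ⊆
      {x | l < (Ioi (1 : ℝ)).indicator (fun t => ENNReal.ofReal (t ^ s)) x} := fun x hx => by
    rw [mem_ofPred_eq, indicator_of_mem (show x ∈ Ioi (1 : ℝ) from hx.1)]
    refine hl.trans_le (ENNReal.ofReal_le_ofReal ?_)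
    exact Real.rpow_le_rpow_of_nonpos (by linarith [hx.1]) hx.2.le hs
  refine lt_of_lt_of_le ?_ (measure_mono hsub)
  rw [Measure.restrict_apply measurableSet_Ioo, inter_eq_left.2 fun x hx => by
    simp only [mem_Ioi]; linarith [hx.1], Real.volume_Ioo]
  exact (ENNReal.ofReal_lt_ofReal_iff (by linarith)).2 (by linarith)

theorem volume_ball_toReal_eq {n : ℕ} (hn : 1 ≤ n) (x : EuclideanSpace ℝ (Fin n)) {r : ℝ}
    (hr : 0 ≤ r) : (volume (Metric.ball x r)).toReal
      = (volume (Metric.ball (0 : EuclideanSpace ℝ (Fin n)) 1)).toReal * r ^ n := by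
  have : Nonempty (Fin n) := ⟨⟨0, hn⟩⟩
  rw [Measure.addHaar_ball _ _ hr, ENNReal.toReal_mul, ENNReal.toReal_ofReal (by positivity),
    finrank_euclideanSpace_fin, mul_comm]

theorem le_radialRearrangement_indicator_rpow {n : ℕ} (hn : 1 ≤ n)
    (x : EuclideanSpace ℝ (Fin n)) :
    ENNReal.ofReal ((2 + (volume (Metric.ball (0 : EuclideanSpace ℝ (Fin n)) 1)).toReal * ‖x‖ ^ n)
      ^ (1 / (n : ℝ) - 1)) ≤ radialRearrangement n
        ((Ioi (1 : ℝ)).indicator fun t => ENNReal.ofReal (t ^ (1 / (n : ℝ) - 1))) x := by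
  rw [← volume_ball_toReal_eq hn 0 (norm_nonneg x)]
  refine le_rearrangement_indicator_rpow ?_ ENNReal.toReal_nonneg
  have : (1 : ℝ) ≤ n := by exact_mod_cast hn
  rw [sub_nonpos]
  exact (div_le_one (by linarith)).2 this

/-- Write `m^(n-1) = (mⁿ)^(1 - 1/n)`; then all reduces to `mⁿ (2 + w dⁿ) ≤ 2 + w Dⁿ`, which follows
from `m ≤ 1` and `m d ≤ D`. It turns the decay of the ray integral into that of the kernel. -/
theorem mul_pow_le_mul_rpow {n : ℕ} (hn : 1 ≤ n) {D d w m : ℝ} (hD : 0 ≤ D) (hd : 0 ≤ d)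
    (hw : 0 ≤ w) (hm0 : 0 ≤ m) (hm1 : m ≤ 1) (hm : m * d ≤ D) :
    D * m ^ (n - 1) ≤
      D * (2 + w * D ^ n) ^ (1 - 1 / (n : ℝ)) * (2 + w * d ^ n) ^ (1 / (n : ℝ) - 1) := by
  have hn' : (1 : ℝ) ≤ n := by exact_mod_cast hn
  have hq : 0 ≤ 1 - 1 / (n : ℝ) := sub_nonneg.2 ((div_le_one (by linarith)).2 hn')
  have hpos : 0 < 2 + w * d ^ n := by positivity
  have h1 : m ^ (n - 1) = (m ^ n) ^ (1 - 1 / (n : ℝ)) := by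
    rw [← Real.rpow_natCast m n, ← Real.rpow_mul hm0, ← Real.rpow_natCast, Nat.cast_sub hn]
    congr 1
    field_simp
    simp
  have h2 : m ^ n * (2 + w * d ^ n) ≤ 2 + w * D ^ n := by
    have h3 : (m * d) ^ n ≤ D ^ n := pow_le_pow_left₀ (by positivity) hm n
    have h4 : m ^ n ≤ 1 := pow_le_one₀ hm0 hm1
    calc m ^ n * (2 + w * d ^ n) = 2 * m ^ n + w * (m * d) ^ n := by rw [mul_pow]; ring
      _ ≤ 2 + w * D ^ n := by nlinarith [mul_le_mul_of_nonneg_left h3 hw]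
  rw [mul_assoc, h1]
  refine mul_le_mul_of_nonneg_left ?_ hD
  rw [← neg_sub (1 : ℝ) (1 / n), Real.rpow_neg hpos.le, ← div_eq_mul_inv,
    le_div_iff₀ (Real.rpow_pos_of_pos hpos _), ← Real.mul_rpow (by positivity) hpos.le]
  exact Real.rpow_le_rpow (by positivity) h2 hq

/-! ### The radial vector field -/

/-- The weighted average `∫ₐ¹ t^(n-1) ψ(p + t (y - p)) dt` of `ψ` along the ray from `p`. Multiplied
by `y - p`, it is a vector field with divergence `ψ(y) - aⁿ ψ(p + a (y - p))`. -/
noncomputable def rayIntegral {E : Type*} [NormedAddCommGroup E] [NormedSpace ℝ E] (n : ℕ) (a : ℝ)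
    (p : E) (ψ : E → ℝ) (y : E) : ℝ :=
  ∫ t in a..1, t ^ (n - 1) * ψ (p + t • (y - p))

section rayIntegral

variable {E : Type*} [NormedAddCommGroup E] [NormedSpace ℝ E] {n : ℕ} {a : ℝ} {p : E} {ψ : E → ℝ}

/-- The integral is a convolution in `t`, with parameter `y`, evaluated at `0`, so smoothness
follows from that of parametrised convolutions. -/
theorem contDiff_rayIntegral (ha0 : 0 ≤ a) (ha1 : a ≤ 1)
    (hψ : ContDiff ℝ ((⊤ : ℕ∞) : WithTop ℕ∞) ψ) :
    ContDiff ℝ ((⊤ : ℕ∞) : WithTop ℕ∞) (rayIntegral n a p ψ) := by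
  let χ : ContDiffBump (0 : ℝ) := ⟨1, 2, one_pos, one_lt_two⟩
  let f : ℝ → ℝ := (Ioc a 1).indicator fun t => t ^ (n - 1)
  -- Convolution at `0` evaluates `g y` at `-t`, hence the sign. The cutoff `χ` supplies compact
  -- support in `t` and equals `1` where `f` lives.
  let g : E → ℝ → ℝ := fun y t => χ t * ψ (p + (-t) • (y - p))
  have hf : LocallyIntegrable f volume := by
    refine IntegrableOn.integrable_indicator ?_ measurableSet_Ioc |>.locallyIntegrable
    exact ((continuous_pow (n - 1)).integrableOn_Icc).mono_set Ioc_subset_Icc_self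
  have hg : ContDiff ℝ ((⊤ : ℕ∞) : WithTop ℕ∞) ↿g := by
    refine (χ.contDiff.comp contDiff_snd).mul (hψ.comp ?_)
    exact contDiff_const.add (contDiff_snd.neg.smul (contDiff_fst.sub contDiff_const))
  have key := contDiffOn_convolution_right_with_param_comp (μ := volume) (n := (⊤ : ℕ∞))
    (ContinuousLinearMap.mul ℝ ℝ)
    (s := univ) (v := fun _ : E => (0 : ℝ)) contDiffOn_const (f := f) (g := g)
    (k := Metric.closedBall 0 2) isOpen_univ (isCompact_closedBall _ _)
    (fun y t _ ht => by
      have : χ t = 0 := χ.zero_of_le_dist (by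
        simpa [χ] using (not_le.1 fun h => ht (mem_closedBall_zero_iff.2 h)).le)
      simp [g, this]) hf hg.contDiffOn
  rw [contDiffOn_univ] at key
  convert key using 1
  funext y
  rw [rayIntegral, intervalIntegral.integral_of_le ha1, convolution_def,
    ← integral_indicator measurableSet_Ioc]
  refine integral_congr_ae (Eventually.of_forall fun t => ?_)
  by_cases ht : t ∈ Ioc a 1
  · have hχ : χ (-t) = 1 := χ.one_of_mem_closedBall (by
      simp only [χ, Metric.mem_closedBall, dist_zero_right, norm_neg, Real.norm_eq_abs]
      rw [abs_of_nonneg (ha0.trans ht.1.le)]; exact ht.2)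
    simp [f, g, ht, hχ]
  · simp [f, ht]

theorem hasFDerivAt_rayIntegral (hψ : ContDiff ℝ 1 ψ) (hψc : HasCompactSupport ψ) (y : E) :
    HasFDerivAt (rayIntegral n a p ψ)
      (∫ t in a..1, t ^ (n - 1) • t • fderiv ℝ ψ (p + t • (y - p))) y := by
  have hc := hψ.continuous
  have hc' := hψ.continuous_fderiv one_ne_zero
  obtain ⟨C, hC⟩ := (hψc.fderiv ℝ).exists_bound_of_continuous hc'
  refine intervalIntegral.hasFDerivAt_integral_of_dominated_of_fderiv_le
    (F := fun y t => t ^ (n - 1) * ψ (p + t • (y - p)))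
    (F' := fun y t => t ^ (n - 1) • t • fderiv ℝ ψ (p + t • (y - p)))
    (bound := fun t => ‖t ^ (n - 1)‖ * (‖t‖ * C)) univ_mem
    (Eventually.of_forall fun x => Continuous.aestronglyMeasurable (by fun_prop))
    (Continuous.intervalIntegrable (by fun_prop) _ _)
    (Continuous.aestronglyMeasurable (by fun_prop)) ?_
    (Continuous.intervalIntegrable (by fun_prop) _ _) ?_
  · refine Eventually.of_forall fun t _ x _ => ?_
    rw [norm_smul, norm_smul]
    gcongr
    exact hC _
  · refine Eventually.of_forall fun t _ x _ => ?_
    have h1 : HasFDerivAt (fun x : E => p + t • (x - p)) (t • ContinuousLinearMap.id ℝ E) x :=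
      (((hasFDerivAt_id x).sub_const p).const_smul t).const_add p
    have h2 := ((hψ.differentiable one_ne_zero _).hasFDerivAt.comp x h1).const_mul (t ^ (n - 1))
    refine h2.congr_fderiv ?_
    ext z
    simp

/-- The divergence identity, in terms of the Euler operator `y - p ↦ J'(y) (y - p)`. -/
theorem rayIntegral_euler (hn : 1 ≤ n) (hψ : ContDiff ℝ 1 ψ) (hψc : HasCompactSupport ψ) (y : E) :
    n * rayIntegral n a p ψ y + fderiv ℝ (rayIntegral n a p ψ) y (y - p)
      = ψ y - a ^ n * ψ (p + a • (y - p)) := by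
  have hc := hψ.continuous
  have hc' := hψ.continuous_fderiv one_ne_zero
  -- Integrating this derivative over `[a, 1]` gives the identity.
  have hd : ∀ t : ℝ, HasDerivAt (fun t : ℝ => t ^ n * ψ (p + t • (y - p)))
      (n * t ^ (n - 1) * ψ (p + t • (y - p))
        + t ^ n * fderiv ℝ ψ (p + t • (y - p)) (y - p)) t := fun t => by
    have h1 : HasDerivAt (fun t : ℝ => p + t • (y - p)) (y - p) t := by
      simpa using ((hasDerivAt_id t).smul_const (y - p)).const_add p
    exact (hasDerivAt_pow n t).mul
      ((hψ.differentiable one_ne_zero _).hasFDerivAt.comp_hasDerivAt t h1)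
  have hI := intervalIntegral.integral_eq_sub_of_hasDerivAt (a := a) (b := 1) (fun t _ => hd t)
    (Continuous.intervalIntegrable (by fun_prop) _ _)
  simp only [one_pow, one_mul, one_smul, add_sub_cancel] at hI
  rw [← hI, (hasFDerivAt_rayIntegral hψ hψc y).fderiv,
    ContinuousLinearMap.intervalIntegral_apply (Continuous.intervalIntegrable (by fun_prop) _ _),
    rayIntegral, ← intervalIntegral.integral_const_mul, ← intervalIntegral.integral_add
      (Continuous.intervalIntegrable (by fun_prop) _ _)
      (Continuous.intervalIntegrable (by fun_prop) _ _)]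
  refine intervalIntegral.integral_congr fun t _ => ?_
  have : t ^ n = t ^ (n - 1) * t := by rw [← pow_succ, Nat.sub_add_cancel hn]
  simp only [smul_apply, smul_eq_mul, this]
  ring

theorem rayIntegral_nonneg (ha0 : 0 ≤ a) (ha1 : a ≤ 1) (h0 : ∀ x, 0 ≤ ψ x) (y : E) :
    0 ≤ rayIntegral n a p ψ y :=
  intervalIntegral.integral_nonneg ha1 fun t ht =>
    mul_nonneg (pow_nonneg (ha0.trans ht.1) _) (h0 (p + t • (y - p)))

/-- For such `y` the whole segment of integration misses the support of `ψ`. Positivity of `a` is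
what makes the field compactly supported. -/
theorem rayIntegral_eq_zero {D : ℝ} (ha0 : 0 < a) (ha1 : a ≤ 1)
    (hD : ∀ x, ψ x ≠ 0 → ‖x - p‖ ≤ D) {y : E} (hy : D < a * ‖y - p‖) :
    rayIntegral n a p ψ y = 0 := by
  rw [rayIntegral, intervalIntegral.integral_congr (g := fun _ => (0 : ℝ)),
    intervalIntegral.integral_zero]
  intro t ht
  rw [uIcc_of_le ha1] at ht
  have : ψ (p + t • (y - p)) = 0 := by
    by_contra h
    have h1 := hD _ h
    rw [add_sub_cancel_left, norm_smul, Real.norm_of_nonneg (ha0.le.trans ht.1)] at h1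
    exact absurd (h1.trans_lt hy) (not_lt.2 (mul_le_mul_of_nonneg_right ht.1 (norm_nonneg _)))
  simp [this]

theorem rayIntegral_le_pow {D m : ℝ} (hn : 1 ≤ n) (ha0 : 0 ≤ a)
    (hψ : Continuous ψ) (h0 : ∀ x, 0 ≤ ψ x) (h1 : ∀ x, ψ x ≤ 1)
    (hD : ∀ x, ψ x ≠ 0 → ‖x - p‖ ≤ D) {y : E} (hm0 : 0 ≤ m) (hm1 : m ≤ 1)
    (hm : ∀ t : ℝ, t * ‖y - p‖ ≤ D → t ≤ 1 → t ≤ m) :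
    rayIntegral n a p ψ y ≤ m ^ n := by
  have hcont : Continuous fun t : ℝ => t ^ (n - 1) * ψ (p + t • (y - p)) := by fun_prop
  -- Extending the range down to `0` removes `a`, and with it the larger ball, from the bound.
  have hle : rayIntegral n a p ψ y ≤ ∫ t in (0 : ℝ)..1, t ^ (n - 1) * ψ (p + t • (y - p)) := by
    rw [rayIntegral, ← intervalIntegral.integral_add_adjacent_intervals
      (hcont.intervalIntegrable 0 a) (hcont.intervalIntegrable a 1)]
    exact le_add_of_nonneg_left (intervalIntegral.integral_nonneg ha0 fun t ht =>
      mul_nonneg (pow_nonneg ht.1 _) (h0 _))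
  refine hle.trans ?_
  rw [← intervalIntegral.integral_add_adjacent_intervals
      (hcont.intervalIntegrable 0 m) (hcont.intervalIntegrable m 1)]
  have hz : ∫ t in m..1, t ^ (n - 1) * ψ (p + t • (y - p)) = 0 := by
    rw [intervalIntegral.integral_of_le hm1]
    refine setIntegral_eq_zero_of_forall_eq_zero fun t ht => ?_
    have : ψ (p + t • (y - p)) = 0 := by
      by_contra h
      have h2 := hD _ h
      rw [add_sub_cancel_left, norm_smul, Real.norm_of_nonneg (hm0.trans ht.1.le)] at h2
      exact absurd (hm t h2 ht.2) (not_le.2 ht.1)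
    simp [this]
  rw [hz, add_zero]
  calc ∫ t in (0 : ℝ)..m, t ^ (n - 1) * ψ (p + t • (y - p))
      ≤ ∫ t in (0 : ℝ)..m, m ^ (n - 1) := by
        refine intervalIntegral.integral_mono_on hm0 (hcont.intervalIntegrable _ _)
          (by simp) fun t ht => ?_
        calc t ^ (n - 1) * ψ (p + t • (y - p)) ≤ m ^ (n - 1) * 1 :=
              mul_le_mul (pow_le_pow_left₀ ht.1 ht.2 _) (h1 _) (h0 _) (by positivity)
          _ = m ^ (n - 1) := mul_one _
    _ = m ^ n := by
        rw [intervalIntegral.integral_const, sub_zero, smul_eq_mul, ← pow_succ',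
          Nat.sub_add_cancel hn]

theorem norm_sub_mul_rayIntegral_le {D w : ℝ} (hn : 1 ≤ n) (ha0 : 0 ≤ a)
    (hψ : Continuous ψ) (h0 : ∀ x, 0 ≤ ψ x) (h1 : ∀ x, ψ x ≤ 1)
    (hD0 : 0 ≤ D) (hD : ∀ x, ψ x ≠ 0 → ‖x - p‖ ≤ D) (hw : 0 ≤ w) (y : E) :
    ‖y - p‖ * rayIntegral n a p ψ y ≤
      D * (2 + w * D ^ n) ^ (1 - 1 / (n : ℝ)) * (2 + w * ‖y - p‖ ^ n) ^ (1 / (n : ℝ) - 1) := by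
  -- Here `m` stands for `min 1 (D / ‖y - p‖)`, the last parameter at which the ray can meet the
  -- support of `ψ`.
  have key : ∀ m : ℝ, 0 ≤ m → m ≤ 1 → m * ‖y - p‖ ≤ D →
      (∀ t : ℝ, t * ‖y - p‖ ≤ D → t ≤ 1 → t ≤ m) → ‖y - p‖ * rayIntegral n a p ψ y ≤
      D * (2 + w * D ^ n) ^ (1 - 1 / (n : ℝ)) * (2 + w * ‖y - p‖ ^ n) ^ (1 / (n : ℝ) - 1) :=
    fun m hm0 hm1 hm2 hm => by
      refine le_trans ?_ (mul_pow_le_mul_rpow hn hD0 (norm_nonneg _) hw hm0 hm1 hm2)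
      have hJ := rayIntegral_le_pow hn ha0 hψ h0 h1 hD hm0 hm1 hm
      calc ‖y - p‖ * rayIntegral n a p ψ y ≤ ‖y - p‖ * m ^ n := by gcongr
        _ = (m * ‖y - p‖) * m ^ (n - 1) := by
          rw [← mul_pow_sub_one (by omega : n ≠ 0) m]; ring
        _ ≤ D * m ^ (n - 1) := by gcongr
  rcases le_or_gt ‖y - p‖ D with h | h
  · exact key 1 zero_le_one le_rfl (by rwa [one_mul]) fun t _ ht => ht
  · have hpos := hD0.trans_lt h
    exact key (D / ‖y - p‖) (by positivity) ((div_le_one hpos).2 h.le)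
      (div_mul_cancel₀ _ hpos.ne').le fun t ht _ => (le_div_iff₀ hpos).2 ht

end rayIntegral

/-! ### Integration by parts -/

theorem MeasureTheory.LocallyIntegrable.integrable_mul_of_hasCompactSupport {X : Type*}
    [TopologicalSpace X] [T2Space X] [MeasurableSpace X] [OpensMeasurableSpace X] {μ : Measure X}
    {u φ : X → ℝ} (hu : LocallyIntegrable u μ) (hφ : Continuous φ) (hφc : HasCompactSupport φ) :
    Integrable (fun x => u x * φ x) μ := by
  simpa [smul_eq_mul, mul_comm] using hu.integrable_smul_left_of_hasCompactSupport hφ hφc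

/-- A function tested against the divergence of the radial vector field `(y - p) J(y)` is controlled
by its weak gradient. -/
theorem enorm_integral_mul_sub_homothety_le {n : ℕ} (hn : 1 ≤ n)
    {u : EuclideanSpace ℝ (Fin n) → ℝ} (hu : LocallyIntegrable u volume)
    {v : Fin n → EuclideanSpace ℝ (Fin n) → ℝ} (hv : ∀ i, IsWeakPartialDeriv i u (v i))
    {ψ : EuclideanSpace ℝ (Fin n) → ℝ} (hψ : ContDiff ℝ ((⊤ : ℕ∞) : WithTop ℕ∞) ψ)
    (hψc : HasCompactSupport ψ) (h0 : ∀ x, 0 ≤ ψ x) (h1 : ∀ x, ψ x ≤ 1)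
    {a D w : ℝ} {p : EuclideanSpace ℝ (Fin n)} (ha0 : 0 < a) (ha1 : a ≤ 1) (hD0 : 0 ≤ D)
    (hD : ∀ x, ψ x ≠ 0 → ‖x - p‖ ≤ D) (hw : 0 ≤ w) :
    ‖(∫ y, u y * ψ y) - a ^ n * ∫ y, u y * ψ (p + a • (y - p))‖ₑ ≤
      ∫⁻ y, (∑ i, ‖v i y‖ₑ) * ENNReal.ofReal (D * (2 + w * D ^ n) ^ (1 - 1 / (n : ℝ)) *
        (2 + w * ‖y - p‖ ^ n) ^ (1 / (n : ℝ) - 1)) := by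
  set J := rayIntegral n a p ψ with hJdef
  set K : EuclideanSpace ℝ (Fin n) → ℝ≥0∞ := fun y => ENNReal.ofReal
    (D * (2 + w * D ^ n) ^ (1 - 1 / (n : ℝ)) * (2 + w * ‖y - p‖ ^ n) ^ (1 / (n : ℝ) - 1)) with hK
  have hKm : Measurable K := by fun_prop
  have hψ1 : ContDiff ℝ 1 ψ := hψ.of_le (by exact_mod_cast le_top)
  have hJ : ContDiff ℝ ((⊤ : ℕ∞) : WithTop ℕ∞) J := contDiff_rayIntegral ha0.le ha1 hψ
  have hJ1 : ContDiff ℝ 1 J := hJ.of_le (by exact_mod_cast le_top)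
  have hfar : ∀ y, y ∉ Metric.closedBall p (D / a) → D < a * ‖y - p‖ := fun y hy => by
    rw [mem_closedBall_iff_norm, not_le, div_lt_iff₀' ha0] at hy
    exact hy
  -- The components of the field serve as test functions for the weak derivatives.
  let Φ : Fin n → EuclideanSpace ℝ (Fin n) → ℝ := fun i y => (y i - p i) * J y
  have hcoord : ∀ i, ContDiff ℝ ((⊤ : ℕ∞) : WithTop ℕ∞)
      fun y : EuclideanSpace ℝ (Fin n) => y i - p i := fun i =>
    (EuclideanSpace.proj (𝕜 := ℝ) i : EuclideanSpace ℝ (Fin n) →L[ℝ] ℝ).contDiff.sub contDiff_const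
  have hΦ : ∀ i, ContDiff ℝ ((⊤ : ℕ∞) : WithTop ℕ∞) (Φ i) := fun i => (hcoord i).mul hJ
  have hΦc : ∀ i, HasCompactSupport (Φ i) := fun i =>
    HasCompactSupport.intro (isCompact_closedBall p (D / a)) fun y hy => by
      simp only [Φ, hJdef, rayIntegral_eq_zero ha0 ha1 hD (hfar y hy), mul_zero]
  have hΦ' : ∀ i y, fderiv ℝ (Φ i) y (EuclideanSpace.single i 1)
      = J y + (y i - p i) * fderiv ℝ J y (EuclideanSpace.single i 1) := fun i y => by
    have hc : HasFDerivAt (fun y : EuclideanSpace ℝ (Fin n) => y i - p i)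
        (EuclideanSpace.proj (𝕜 := ℝ) i : EuclideanSpace ℝ (Fin n) →L[ℝ] ℝ) y :=
      (EuclideanSpace.proj (𝕜 := ℝ) i : EuclideanSpace ℝ (Fin n) →L[ℝ] ℝ).hasFDerivAt.sub_const _
    have hm : HasFDerivAt (Φ i) _ y := hc.mul (hJ1.differentiable one_ne_zero y).hasFDerivAt
    rw [hm.fderiv]
    simp
    ring
  have hdiv : ∀ y, ∑ i, fderiv ℝ (Φ i) y (EuclideanSpace.single i 1)
      = ψ y - a ^ n * ψ (p + a • (y - p)) := fun y => by
    rw [← rayIntegral_euler hn hψ1 hψc y]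
    simp only [hΦ', Finset.sum_add_distrib, Finset.sum_const, Finset.card_univ, Fintype.card_fin,
      nsmul_eq_mul]
    congr 1
    have hy : y - p = ∑ i, (y i - p i) • EuclideanSpace.single i (1 : ℝ) := by
      ext j
      simp [Finset.sum_apply, Pi.single_apply]
    conv_rhs => rw [hy, map_sum]
    simp [hJdef]
  have hi1 : Integrable (fun y => u y * ψ y) :=
    hu.integrable_mul_of_hasCompactSupport hψ.continuous hψc
  have hi2 : Integrable (fun y => u y * ψ (p + a • (y - p))) := by
    refine hu.integrable_mul_of_hasCompactSupport (by have := hψ.continuous; fun_prop)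
      (HasCompactSupport.intro (isCompact_closedBall p (D / a)) fun y hy => ?_)
    by_contra h
    have h2 := hD _ h
    rw [add_sub_cancel_left, norm_smul, Real.norm_of_nonneg ha0.le] at h2
    exact absurd h2 (not_le.2 (hfar y hy))
  have hi3 : ∀ i, Integrable (fun y => u y * fderiv ℝ (Φ i) y (EuclideanSpace.single i 1)) :=
    fun i => hu.integrable_mul_of_hasCompactSupport
      (((hΦ i).continuous_fderiv (by simp)).clm_apply continuous_const)
      ((hΦc i).fderiv_apply ℝ _)
  have hmain : (∫ y, u y * ψ y) - a ^ n * ∫ y, u y * ψ (p + a • (y - p))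
      = -∑ i, ∫ y, v i y * Φ i y := by
    rw [← integral_const_mul, ← integral_sub hi1 (hi2.const_mul _), ← Finset.sum_neg_distrib]
    simp_rw [← (hv _).2 _ (hΦ _) (hΦc _)]
    rw [← integral_finsetSum _ fun i _ => hi3 i]
    refine integral_congr_ae (Eventually.of_forall fun y => ?_)
    simp only
    rw [← Finset.mul_sum, hdiv]
    ring
  have hΦK : ∀ i y, ‖Φ i y‖ₑ ≤ K y := fun i y => by
    rw [← ofReal_norm]
    refine ENNReal.ofReal_le_ofReal (le_trans ?_ (norm_sub_mul_rayIntegral_le hn ha0.le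
      hψ.continuous h0 h1 hD0 hD hw y))
    rw [norm_mul, Real.norm_of_nonneg (rayIntegral_nonneg ha0.le ha1 h0 y)]
    exact mul_le_mul_of_nonneg_right (PiLp.norm_apply_le (y - p) i)
      (rayIntegral_nonneg ha0.le ha1 h0 y)
  have hvm : ∀ i, AEMeasurable (fun y => ‖v i y‖ₑ) := fun i =>
    (hv i).1.aestronglyMeasurable.enorm
  rw [hmain, enorm_neg]
  calc ‖∑ i, ∫ y, v i y * Φ i y‖ₑ ≤ ∑ i, ‖∫ y, v i y * Φ i y‖ₑ := enorm_sum_le _ _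
    _ ≤ ∑ i, ∫⁻ y, ‖v i y‖ₑ * K y := by
        refine Finset.sum_le_sum fun i _ => (enorm_integral_le_lintegral_enorm _).trans
          (lintegral_mono fun y => ?_)
        rw [enorm_mul]
        gcongr
        exact hΦK i y
    _ = ∫⁻ y, (∑ i, ‖v i y‖ₑ) * K y := by
        simp_rw [Finset.sum_mul]
        exact (lintegral_finsetSum' _ fun i _ => (hvm i).mul hKm.aemeasurable).symm

/-! ### From smooth functions to indicators of balls -/

theorem tendsto_integral_mul_of_tendsto_indicator {α : Type*} [MeasurableSpace α] {μ : Measure α}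
    {S : Set α} (hS : MeasurableSet S) {u : α → ℝ} (hu : AEStronglyMeasurable u μ)
    (huS : IntegrableOn u S μ)
    {φ : ℕ → α → ℝ} (hφm : ∀ j, AEStronglyMeasurable (φ j) μ)
    (hφ : ∀ j x, ‖φ j x‖ ≤ S.indicator 1 x)
    (hlim : ∀ x, Tendsto (fun j => φ j x) atTop (𝓝 (S.indicator 1 x))) :
    Tendsto (fun j => ∫ x, u x * φ j x ∂μ) atTop (𝓝 (∫ x in S, u x ∂μ)) := by
  rw [← integral_indicator hS]
  refine tendsto_integral_of_dominated_convergence (S.indicator fun x => ‖u x‖)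
    (fun j => hu.mul (hφm j)) ((integrable_indicator_iff hS).2 huS.norm) (fun j => ?_) ?_
  · refine Eventually.of_forall fun x => ?_
    rw [norm_mul]
    refine (mul_le_mul_of_nonneg_left (hφ j x) (norm_nonneg _)).trans_eq ?_
    by_cases hx : x ∈ S <;> simp [hx]
  · refine Eventually.of_forall fun x => ?_
    have := (hlim x).const_mul (u x)
    by_cases hx : x ∈ S <;> simpa [hx] using this

theorem exists_contDiff_tendsto_indicator_ball {E : Type*} [NormedAddCommGroup E]
    [NormedSpace ℝ E] [FiniteDimensional ℝ E] (c : E) {r : ℝ} (hr : 0 < r) :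
    ∃ φ : ℕ → E → ℝ, (∀ j, ContDiff ℝ ((⊤ : ℕ∞) : WithTop ℕ∞) (φ j)) ∧
      (∀ j, HasCompactSupport (φ j)) ∧ (∀ j x, 0 ≤ φ j x) ∧
      (∀ j x, φ j x ≤ (Metric.ball c r).indicator 1 x) ∧
      ∀ x, Tendsto (fun j => φ j x) atTop (𝓝 ((Metric.ball c r).indicator 1 x)) := by
  -- Inner radii of the bumps; the shift by `2` keeps them positive already at `j = 0`.
  have hlt : ∀ j : ℕ, r * (1 - 1 / ((j : ℝ) + 2)) < r := fun j => by
    have : 0 < 1 / ((j : ℝ) + 2) := by positivity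
    nlinarith
  have hpos : ∀ j : ℕ, 0 < r * (1 - 1 / ((j : ℝ) + 2)) := fun j => by
    refine mul_pos hr (sub_pos.2 ((div_lt_one (by positivity)).2 ?_))
    have : (0 : ℝ) ≤ j := j.cast_nonneg
    linarith
  let χ : ℕ → ContDiffBump c := fun j => ⟨r * (1 - 1 / ((j : ℝ) + 2)), r, hpos j, hlt j⟩
  refine ⟨fun j => χ j, fun j => (χ j).contDiff, fun j => (χ j).hasCompactSupport,
    fun j x => (χ j).nonneg, fun j x => ?_, fun x => ?_⟩
  · by_cases hx : x ∈ Metric.ball c r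
    · simpa [hx] using (χ j).le_one
    · rw [indicator_of_notMem hx]
      exact ((χ j).zero_of_le_dist (not_lt.1 hx)).le
  · by_cases hx : x ∈ Metric.ball c r
    · rw [indicator_of_mem hx, Pi.one_apply]
      have hl : Tendsto (fun j : ℕ => r * (1 - 1 / ((j : ℝ) + 2))) atTop (𝓝 (r * (1 - 0))) := by
        refine (tendsto_const_nhds.sub ?_).const_mul r
        have := (tendsto_one_div_add_atTop_nhds_zero_nat (𝕜 := ℝ)).comp (tendsto_add_atTop_nat 1)
        refine this.congr fun j => ?_
        simp only [Function.comp, Nat.cast_add, Nat.cast_one]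
        ring
      rw [sub_zero, mul_one] at hl
      refine tendsto_const_nhds.congr' ?_
      filter_upwards [hl.eventually (lt_mem_nhds (Metric.mem_ball.1 hx))] with j hj
      exact ((χ j).one_of_mem_closedBall hj.le).symm
    · rw [indicator_of_notMem hx]
      refine tendsto_const_nhds.congr fun j => ?_
      exact ((χ j).zero_of_le_dist (not_lt.1 hx)).symm

/-- The smooth estimate passes to the limit because its right side depends on `ψ` only through `D`;
here `D = 2 r`, as `p` is within `r` of the centre. -/
theorem enorm_setIntegral_ball_sub_homothety_le {n : ℕ} (hn : 1 ≤ n)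
    {u : EuclideanSpace ℝ (Fin n) → ℝ} (hu : LocallyIntegrable u volume)
    {v : Fin n → EuclideanSpace ℝ (Fin n) → ℝ} (hv : ∀ i, IsWeakPartialDeriv i u (v i))
    {c c' p : EuclideanSpace ℝ (Fin n)} {a w r r' : ℝ} (ha0 : 0 < a) (ha1 : a ≤ 1) (hr : 0 < r)
    (hp : ‖c - p‖ ≤ r) (hw : 0 ≤ w)
    (hball : ∀ y, p + a • (y - p) ∈ Metric.ball c r ↔ y ∈ Metric.ball c' r') :
    ‖(∫ y in Metric.ball c r, u y) - a ^ n * ∫ y in Metric.ball c' r', u y‖ₑ ≤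
      ∫⁻ y, (∑ i, ‖v i y‖ₑ) * ENNReal.ofReal
        (2 * r * (2 + w * (2 * r) ^ n) ^ (1 - 1 / (n : ℝ)) *
          (2 + w * ‖y - p‖ ^ n) ^ (1 / (n : ℝ) - 1)) := by
  obtain ⟨φ, hφ, hφc, hφ0, hφ1, hφlim⟩ := exists_contDiff_tendsto_indicator_ball c hr
  have hint : ∀ (x : EuclideanSpace ℝ (Fin n)) (s : ℝ), IntegrableOn u (Metric.ball x s) :=
    fun x s => (hu.integrableOn_isCompact (isCompact_closedBall x s)).mono_set
      Metric.ball_subset_closedBall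
  have hind : ∀ y, (Metric.ball c r).indicator (1 : EuclideanSpace ℝ (Fin n) → ℝ)
      (p + a • (y - p)) = (Metric.ball c' r').indicator 1 y := fun y => by
    by_cases hy : y ∈ Metric.ball c' r'
    · rw [indicator_of_mem hy, indicator_of_mem ((hball y).2 hy)]; rfl
    · rw [indicator_of_notMem hy, indicator_of_notMem (mt (hball y).1 hy)]
  have hnorm : ∀ j x, ‖φ j x‖ ≤ (Metric.ball c r).indicator 1 x := fun j x => by
    rw [Real.norm_of_nonneg (hφ0 j x)]; exact hφ1 j x
  have h1 := tendsto_integral_mul_of_tendsto_indicator measurableSet_ball hu.aestronglyMeasurable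
    (hint c r) (fun j => (hφ j).continuous.aestronglyMeasurable) hnorm hφlim
  have h2 := tendsto_integral_mul_of_tendsto_indicator measurableSet_ball hu.aestronglyMeasurable
    (hint c' r') (φ := fun j y => φ j (p + a • (y - p)))
    (fun j => Continuous.aestronglyMeasurable (by have := (hφ j).continuous; fun_prop))
    (fun j y => by rw [← hind]; exact hnorm j _) (fun y => by rw [← hind]; exact hφlim _)
  refine le_of_tendsto (h1.sub (h2.const_mul (a ^ n))).enorm (Eventually.of_forall fun j => ?_)
  refine enorm_integral_mul_sub_homothety_le hn hu hv (hφ j) (hφc j) (hφ0 j)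
    (fun x => (hφ1 j x).trans (indicator_le_self' (by simp) x)) ha0 ha1 (by positivity)
    (fun x hx => ?_) hw
  have hx' : x ∈ Metric.ball c r := by
    by_contra h
    refine hx (le_antisymm ?_ (hφ0 j x))
    simpa [h] using hφ1 j x
  calc ‖x - p‖ ≤ ‖x - c‖ + ‖c - p‖ := norm_sub_le_norm_sub_add_norm_sub _ _ _
    _ ≤ 2 * r := by linarith [mem_ball_iff_norm.1 hx']

/-! ### Nested balls and the uniform bound -/

/-- Test the inclusion on points of the smaller ball lying from `c` in the direction away from `c'`.
When the centres coincide, nontriviality of `E` provides a direction. -/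
theorem dist_add_le_of_ball_subset_ball {E : Type*} [NormedAddCommGroup E] [NormedSpace ℝ E]
    [Nontrivial E] {c c' : E} {r r' : ℝ} (hr : 0 < r)
    (h : Metric.ball c r ⊆ Metric.ball c' r') : dist c c' + r ≤ r' := by
  obtain ⟨e, he, hce⟩ : ∃ e : E, ‖e‖ = 1 ∧ c - c' = ‖c - c'‖ • e := by
    rcases eq_or_ne (c - c') 0 with h0 | h0
    · obtain ⟨e, he⟩ := exists_norm_eq E zero_le_one
      exact ⟨e, he, by simp [h0]⟩
    · refine ⟨‖c - c'‖⁻¹ • (c - c'), ?_, ?_⟩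
      · rw [norm_smul, norm_inv, norm_norm, inv_mul_cancel₀ (norm_ne_zero_iff.2 h0)]
      · rw [smul_smul, mul_inv_cancel₀ (norm_ne_zero_iff.2 h0), one_smul]
  rw [dist_eq_norm]
  refine le_of_forall_lt fun s hs => ?_
  have hs' : max (s - ‖c - c'‖) 0 < r := max_lt (by linarith) hr
  have hmem : c + max (s - ‖c - c'‖) 0 • e ∈ Metric.ball c r := by
    rw [mem_ball_iff_norm, add_sub_cancel_left, norm_smul, he, mul_one,
      Real.norm_of_nonneg (le_max_right _ _)]
    exact hs'
  have h2 := mem_ball_iff_norm.1 (h hmem)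
  have h3 : c + max (s - ‖c - c'‖) 0 • e - c' = (‖c - c'‖ + max (s - ‖c - c'‖) 0) • e := by
    rw [add_smul, ← hce]; abel
  rw [h3, norm_smul, he, mul_one, Real.norm_of_nonneg (by positivity)] at h2
  linarith [le_max_left (s - ‖c - c'‖) 0]

/-- The averages over two nested balls differ by at most a constant that depends only on the smaller
ball. -/
theorem enorm_setAverage_ball_sub_setAverage_ball_le {n : ℕ} (hn : 1 ≤ n)
    {ρ : (EuclideanSpace ℝ (Fin n) → ℝ≥0∞) → ℝ≥0∞} (hρ : IsRINorm volume ρ)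
    {u : EuclideanSpace ℝ (Fin n) → ℝ} (hu : LocallyIntegrable u volume)
    {v : Fin n → EuclideanSpace ℝ (Fin n) → ℝ} (hv : ∀ i, IsWeakPartialDeriv i u (v i))
    (hvρ : ρ (fun x => ∑ i, ‖v i x‖ₑ) < ∞)
    {c c' : EuclideanSpace ℝ (Fin n)} {r r' : ℝ} (hr : 0 < r)
    (h : Metric.ball c r ⊆ Metric.ball c' r') :
    ‖(⨍ x in Metric.ball c r, u x) - ⨍ x in Metric.ball c' r', u x‖ₑ ≤
      ENNReal.ofReal ((volume.real (Metric.ball c r))⁻¹ * (2 * r * (2 +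
        volume.real (Metric.ball (0 : EuclideanSpace ℝ (Fin n)) 1) * (2 * r) ^ n)
          ^ (1 - 1 / (n : ℝ)))) *
        (ρ (fun x => ∑ i, ‖v i x‖ₑ) * representationNorm n (associateNorm volume ρ)
          ((Ioi (1 : ℝ)).indicator fun t => ENNReal.ofReal (t ^ (1 / (n : ℝ) - 1)))) := by
  have : Nonempty (Fin n) := ⟨⟨0, hn⟩⟩
  have hd := dist_add_le_of_ball_subset_ball hr h
  rcases eq_or_ne r r' with rfl | hrr
  · have : c = c' := dist_le_zero.1 (by linarith)
    simp [this]
  have hlt : r < r' := lt_of_le_of_ne (by linarith [dist_nonneg (x := c) (y := c')]) hrr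
  have hr' : 0 < r' := hr.trans hlt
  have hsub : 0 < r' - r := sub_pos.2 hlt
  -- The fixed point of the homothety of ratio `r / r'` sending `c'` to `c`.
  set p : EuclideanSpace ℝ (Fin n) := c + (r / (r' - r)) • (c - c') with hp
  have hpc : ‖c - p‖ ≤ r := by
    rw [hp, sub_add_cancel_left, norm_neg, norm_smul, Real.norm_of_nonneg (by positivity),
      div_mul_eq_mul_div, div_le_iff₀ hsub, ← dist_eq_norm]
    gcongr
    linarith
  set a := r / r' with ha
  have ha0 : 0 < a := by positivity
  have ha1 : a ≤ 1 := (div_le_one hr').2 hlt.le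
  have hpy : ∀ y, p + a • (y - p) - c = a • (y - c') := fun y => by
    have h1 : (1 - a) * (r / (r' - r)) = a := by rw [ha]; field_simp
    have h2 : p + a • (y - p) - c - a • (y - c')
        = ((1 - a) * (r / (r' - r)) - a) • (c - c') := by rw [hp]; module
    rw [h1, sub_self, zero_smul] at h2
    exact sub_eq_zero.1 h2
  have hball : ∀ y, p + a • (y - p) ∈ Metric.ball c r ↔ y ∈ Metric.ball c' r' := fun y => by
    rw [mem_ball_iff_norm, mem_ball_iff_norm, hpy, norm_smul, Real.norm_of_nonneg ha0.le,
      ← lt_div_iff₀' ha0, ha, div_div_cancel₀ hr.ne']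
  set ω := volume.real (Metric.ball (0 : EuclideanSpace ℝ (Fin n)) 1) with hω
  have hω0 : 0 ≤ ω := measureReal_nonneg
  have hvol : ∀ (x : EuclideanSpace ℝ (Fin n)) {s : ℝ}, 0 ≤ s →
      volume.real (Metric.ball x s) = ω * s ^ n := fun x s hs => volume_ball_toReal_eq hn x hs
  -- The factor `aⁿ` from the divergence is the ratio of the volumes, so the difference of integrals
  -- is a multiple of the difference of averages.
  have hV : volume.real (Metric.ball c r) = a ^ n * volume.real (Metric.ball c' r') := by
    rw [hvol _ hr.le, hvol _ hr'.le, ha, div_pow]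
    field_simp
  set V := volume.real (Metric.ball c r) with hVdef
  have havg : (⨍ x in Metric.ball c r, u x) - ⨍ x in Metric.ball c' r', u x
      = V⁻¹ * ((∫ x in Metric.ball c r, u x) - a ^ n * ∫ x in Metric.ball c' r', u x) := by
    rw [setAverage_eq, setAverage_eq, ← hVdef, hV, smul_eq_mul, smul_eq_mul, mul_inv, mul_sub]
    congr 1
    have : a ^ n ≠ 0 := by positivity
    field_simp
  set C := 2 * r * (2 + ω * (2 * r) ^ n) ^ (1 - 1 / (n : ℝ)) with hC
  have hC0 : 0 ≤ C := by positivity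
  have hV0 : 0 ≤ V⁻¹ := inv_nonneg.2 measureReal_nonneg
  set G : ℝ → ℝ≥0∞ := (Ioi (1 : ℝ)).indicator fun t => ENNReal.ofReal (t ^ (1 / (n : ℝ) - 1))
  have hvm : AEMeasurable (fun x => ∑ i, ‖v i x‖ₑ) :=
    Finset.aemeasurable_fun_sum _ fun i _ => (hv i).1.aestronglyMeasurable.enorm
  rw [havg, enorm_mul, ← ofReal_norm V⁻¹, Real.norm_of_nonneg hV0, ENNReal.ofReal_mul hV0, mul_assoc]
  gcongr
  refine (enorm_setIntegral_ball_sub_homothety_le hn hu hv ha0 ha1 hr hpc hω0 hball).trans ?_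
  rw [← hC]
  calc ∫⁻ y, (∑ i, ‖v i y‖ₑ) * ENNReal.ofReal (C * (2 + ω * ‖y - p‖ ^ n) ^ (1 / (n : ℝ) - 1))
      ≤ ∫⁻ y, ENNReal.ofReal C * ((∑ i, ‖v i y‖ₑ) * radialRearrangement n G (y - p)) := by
        refine lintegral_mono fun y => ?_
        simp only
        rw [ENNReal.ofReal_mul hC0, mul_left_comm]
        gcongr
        exact le_radialRearrangement_indicator_rpow hn (y - p)
    _ = ENNReal.ofReal C * ∫⁻ y, (∑ i, ‖v i y‖ₑ) * radialRearrangement n G (y - p) :=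
        lintegral_const_mul' _ _ ENNReal.ofReal_ne_top
    _ ≤ _ := by
        gcongr
        exact lintegral_mul_sub_le_associateNorm hρ hvm hvρ p

theorem proposition3p4 (n : ℕ) (hn : 1 ≤ n)
    (ρ : (EuclideanSpace ℝ (Fin n) → ℝ≥0∞) → ℝ≥0∞) (hρ : IsRINorm volume ρ)
    (hX' : representationNorm n (associateNorm volume ρ)
      ((Ioi (1 : ℝ)).indicator fun t => ENNReal.ofReal (t ^ (1 / (n : ℝ) - 1))) < ∞)
    (u : EuclideanSpace ℝ (Fin n) → ℝ) (hu : u ∈ sobolevV1 n ρ)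
    (c : ℕ → EuclideanSpace ℝ (Fin n)) (r : ℕ → ℝ) (hr : ∀ k, 0 < r k)
    (hB : ∀ k, Metric.ball (c k) (r k) ⊆ Metric.ball (c (k + 1)) (r (k + 1))) :
    Bornology.IsBounded (range fun k => ⨍ x in Metric.ball (c k) (r k), u x) ∧
      ∃ (l : ℝ) (s : ℕ → ℕ), StrictMono s ∧
        Tendsto (fun j => ⨍ x in Metric.ball (c (s j)) (r (s j)), u x) atTop (𝓝 l) := by
  obtain ⟨hul, v, hv, hvρ⟩ := hu
  have hmono : Monotone fun k => Metric.ball (c k) (r k) := monotone_nat_of_le_succ hB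
  have hbdd : Bornology.IsBounded (range fun k => ⨍ x in Metric.ball (c k) (r k), u x) := by
    obtain ⟨K, hK, hle⟩ : ∃ K : ℝ≥0∞, K < ∞ ∧ ∀ k, ‖(⨍ x in Metric.ball (c 0) (r 0), u x)
        - ⨍ x in Metric.ball (c k) (r k), u x‖ₑ ≤ K :=
      -- One constant serves all `k`, since it involves only the first ball.
      ⟨_, ENNReal.mul_lt_top ENNReal.ofReal_lt_top (ENNReal.mul_lt_top hvρ hX'), fun k =>
        enorm_setAverage_ball_sub_setAverage_ball_le hn hρ hul hv hvρ (hr 0)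
          (hmono (Nat.zero_le k))⟩
    refine (Metric.isBounded_iff_subset_closedBall
      (⨍ x in Metric.ball (c 0) (r 0), u x)).2 ⟨K.toReal, range_subset_iff.2 fun k => ?_⟩
    rw [mem_closedBall_iff_norm', ← toReal_enorm]
    exact ENNReal.toReal_mono hK.ne (hle k)
  obtain ⟨l, -, s, hs, hl⟩ := tendsto_subseq_of_bounded hbdd fun k => mem_range_self k
  exact ⟨hbdd, l, s, hs, hl⟩
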